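/- Let $X$ be a nonempty Tychonoff space, and let $C_p(X)$ be the space of continuous functions $X\to\mathbb R$ with the topology of pointwise convergence. Then the following are equivalent: 1. $C_p(X)$ satisfies $S_1(\mathcal S,\mathcal S)$; 2. $X$ satisfies $S_1(\Gamma_F,\Gamma)$, has property $V$, and is strongly zero-dimensional; 3. $X$ satisfies $S_1(\Gamma_{cl},\Gamma_{cl})$, has property $V$, and is strongly zero-dimensional; 4. $C_p(X)$ is sequentially separable and satisfies $S_1(\Gamma_f,\Gamma_f)$ for every $f\in C_p(X)$; 5. $C_p(X)$ is sequentially separable and satisfies $S_1(\mathcal S,\Gamma_f)$ for every $f\in C_p(X)$. Here $S_1(\mathcal A,\mathcal B)$ means: for every sequence $(A_n)_{n}$ of elements of $\mathcal A$ there are $b_n\in A_n$ such that $\{b_n:n\in\mathbb N\}\in\mathcal B$. A subset $D$ of a space is *sequentially dense* if every point of the space is the limit of a sequence of points of $D$; $\mathcal S$ is the family of all sequentially dense subsets of $C_p(X)$, and a space is *sequentially separable* if it has a countable sequentially dense subset. For $f\in C_p(X)$, $\Gamma_f$ is the family of all infinite sets $A\subseteq C_p(X)$ with $f\notin A$ such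 that $A\setminus U$ is finite for every neighbourhood $U$ of $f$. A *$\gamma$-cover* of $X$ is an infinite family $\mathcal U$ of subsets of $X$ with $X\notin\mathcal U$ and $\bigcup\mathcal U=X$ such that each $x\in X$ belongs to all but finitely many elements of $\mathcal U$. $\Gamma$ (respectively $\Gamma_{cl}$) is the family of $\gamma$-covers by open (respectively clopen) sets. A *zero-set* is a set $g^{-1}(0)$ with $g:X\to\mathbb R$ continuous, and a *cozero-set* is the complement of a zero-set. $\Gamma_F$ is the family of $\gamma$-covers $\mathcal U$ by cozero-sets for which there are zero-sets $F(U)\subseteq U$ $(U\in\mathcal U)$ such that $\{F(U):U\in\mathcal U\}$ is a $\gamma$-cover of $X$. $X$ has *property $V$* if there is a continuous bijection $h$ from $X$ onto a separable metric space $Y$ such that $h(U)$ is an $F_\sigma$-set in $Y$ for every cozero-set $U$ of $X$. $X$ is *strongly zero-dimensional* if every finite cover of $X$ by cozero-sets has a finite refinement which is a cover of $X$ by pairwise disjoint open sets. -/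

import Mathlib

universe u

namespace SelCp

/-- The selection principle `S₁(𝒜, ℬ)`. -/
def S1 {α : Type u} (A B : Set (Set α)) : Prop :=
  ∀ s : ℕ → Set α, (∀ n, s n ∈ A) → ∃ b : ℕ → α, (∀ n, b n ∈ s n) ∧ Set.range b ∈ B

/-- The space `C_p(X)` of continuous real functions on `X`. Its topology is the one inherited from
the product `X → ℝ`, that is, the topology of pointwise convergence. -/
abbrev Cp (X : Type u) [TopologicalSpace X] : Type u := {f : X → ℝ // Continuous f}

section Points

variable (T : Type u) [TopologicalSpace T]

/-- The family `𝒮` of sequentially dense subsets of `T`: every point of `T` is the limit of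
a sequence of points of the set. -/
def seqDenseSets : Set (Set T) := {D | seqClosure D = Set.univ}

/-- `T` has a countable sequentially dense subset. -/
def SeqSeparable : Prop := ∃ D : Set T, D.Countable ∧ D ∈ seqDenseSets T

variable {T} in
/-- The family `Γ_x` of the infinite sets `A` with `x ∉ A` that converge to `x`: every neighbourhood
of `x` contains all but finitely many elements of `A`. -/
def gammaAt (x : T) : Set (Set T) :=
  {A | A.Infinite ∧ x ∉ A ∧ ∀ U ∈ nhds x, (A \ U).Finite}

end Points

/-- `γ`-covers of a set `X` by arbitrary subsets; covers are nontrivial, `X ∉ 𝒰`. -/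
def IsGammaCover {X : Type u} (𝒰 : Set (Set X)) : Prop :=
  ⋃₀ 𝒰 = Set.univ ∧ Set.univ ∉ 𝒰 ∧ 𝒰.Infinite ∧ ∀ x : X, {U ∈ 𝒰 | x ∉ U}.Finite

section Covers

/-- The zero-set of a continuous real function. -/
def IsZeroSet {X : Type u} [TopologicalSpace X] (Z : Set X) : Prop :=
  ∃ f : X → ℝ, Continuous f ∧ Z = {x | f x = 0}

/-- Cozero-sets (functionally open sets). -/
def IsCozeroSet {X : Type u} [TopologicalSpace X] (U : Set X) : Prop := IsZeroSet Uᶜ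

/-- `F_σ`-sets: countable unions of closed sets. -/
def IsFsigma {Y : Type u} [TopologicalSpace Y] (s : Set Y) : Prop :=
  ∃ F : ℕ → Set Y, (∀ n, IsClosed (F n)) ∧ s = ⋃ n, F n

variable (X : Type u) [TopologicalSpace X]

/-- The family `Γ` of open `γ`-covers of `X`. -/
def openGamma : Set (Set (Set X)) := {𝒰 | IsGammaCover 𝒰 ∧ ∀ U ∈ 𝒰, IsOpen U}

/-- The family `Γ_cl` of clopen `γ`-covers of `X`. -/
def clopenGamma : Set (Set (Set X)) := {𝒰 | IsGammaCover 𝒰 ∧ ∀ U ∈ 𝒰, IsClopen U}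

/-- The family `Γ_F` of `γ_F`-shrinkable `γ`-covers of `X`: the `γ`-covers `𝒰` by cozero-sets for
which there is a `γ`-cover `{F(U) : U ∈ 𝒰}` by zero-sets with `F(U) ⊆ U` for all `U ∈ 𝒰`. -/
def shrinkableGamma : Set (Set (Set X)) :=
  {𝒰 | IsGammaCover 𝒰 ∧ (∀ U ∈ 𝒰, IsCozeroSet U) ∧
    ∃ F : Set X → Set X, (∀ U ∈ 𝒰, IsZeroSet (F U) ∧ F U ⊆ U) ∧ IsGammaCover (F '' 𝒰)}

/-- Strong zero-dimensionality: every finite cover of `X` by cozero-sets has a finite open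
refinement that consists of pairwise disjoint sets (and covers `X`). -/
def StronglyZeroDimensional : Prop :=
  ∀ (n : ℕ) (U : Fin n → Set X), (∀ i, IsCozeroSet (U i)) → ⋃ i, U i = Set.univ →
    ∃ (m : ℕ) (V : Fin m → Set X), (∀ j, IsOpen (V j)) ∧ (∀ j, ∃ i, V j ⊆ U i) ∧
      ⋃ j, V j = Set.univ ∧ Pairwise fun j k => Disjoint (V j) (V k)

/-- Property `V`: there is a condensation (continuous bijection) of `X` onto a separable metric
space which maps cozero-sets to `F_σ`-sets. (The space `Y` has the cardinality of `X`, so that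
taking it in the universe of `X` is no restriction.) -/
def PropertyV : Prop :=
  ∃ (Y : Type u) (_ : MetricSpace Y) (_ : TopologicalSpace.SeparableSpace Y) (f : X → Y),
    Continuous f ∧ Function.Bijective f ∧ ∀ U : Set X, IsCozeroSet U → IsFsigma (f '' U)

end Covers

end SelCp

/-!
Functions in `C_p(X)` vanishing on zero-sets `F ⊆ U` and equal to `1` off the cozero-sets `U` turn
each of the selection properties of `C_p(X)`, used at the point `0` only, into one of `X`: given
zero-sets `F n m` inside cozero-sets `U n m` such that, for every `n`, each point lies in almost all
`F n m`, one can choose `σ` such that each point lies in almost all `U n (σ n)`. Conversely, if `X`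
is strongly zero-dimensional, a clopen set can be put between `{|A n m - f n| ≤ ε n / 2}` and
`{|A n m - f n| < ε n}`, and a selection from these clopen sets is a diagonal sequence for the
iterated limit `A n m → f n → g` in `C_p(X)`. Diagonal sequences in turn give all the selection
properties of `C_p(X)`.

The selection property makes `X` strongly zero-dimensional because it forbids a continuous
`f : X → ℝ` to take all values in an interval: composed with a Peano curve, `f` would cover the
Hilbert cube.

Property `V` is equivalent to sequential separability of `C_p(X)` by a theorem of Velichko. The
members of a countable sequentially dense set are the coordinates of a condensation of `X`, and
under property `V` every continuous function on `X` is a pointwise limit of functions pulled back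
from the Hilbert cube `Q` (Lebesgue–Hausdorff), where `C(Q)` is separable.
-/

namespace SelCp

open Set Filter Topology

theorem S1.mono {α : Type u} {A A' B B' : Set (Set α)} (h : S1 A B) (hA : A' ⊆ A) (hB : B ⊆ B') :
    S1 A' B' := fun s hs =>
  let ⟨b, hbs, hb⟩ := h s fun n => hA (hs n)
  ⟨b, hbs, hB hb⟩

theorem infinite_range_of_finite_fibers {ι α : Type*} [Infinite ι] {f : ι → α}
    (h : ∀ i, (f ⁻¹' {f i}).Finite) : (range f).Infinite := fun hfin =>
  infinite_univ (α := ι) <| by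
    simpa only [preimage_range] using hfin.preimage' (forall_mem_range.2 h)

section SequentialDensity

variable {T : Type u} [TopologicalSpace T] {x : T}

/-- The family of the sets that contain a sequence converging to `x`, the point `x` itself being
allowed as a term. Both `𝒮` and `Γ_x` are contained in it. -/
def seqLimitSets (x : T) : Set (Set T) := {A | x ∈ seqClosure A}

theorem mem_seqDenseSets_iff {D : Set T} : D ∈ seqDenseSets T ↔ ∀ x, x ∈ seqClosure D :=
  eq_univ_iff_forall

theorem univ_mem_seqDenseSets : univ ∈ seqDenseSets T :=
  eq_univ_of_univ_subset subset_seqClosure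

theorem seqDenseSets_subset_seqLimitSets (x : T) : seqDenseSets T ⊆ seqLimitSets x :=
  fun _ hD => mem_seqDenseSets_iff.1 hD x

theorem exists_injective_tendsto_of_mem_gammaAt {A : Set T} (hA : A ∈ gammaAt x) :
    ∃ b : ℕ → T, Function.Injective b ∧ (∀ n, b n ∈ A) ∧ Tendsto b atTop (𝓝 x) := by
  obtain ⟨hinf, -, hU⟩ := hA
  have hinj : Function.Injective fun n => (hinf.natEmbedding A n : T) :=
    Subtype.val_injective.comp (hinf.natEmbedding A).injective
  refine ⟨_, hinj, fun n => (hinf.natEmbedding A n).2, ?_⟩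
  rw [← Nat.cofinite_eq_atTop]
  exact fun U hUx => ((hU U hUx).preimage hinj.injOn).subset
    fun n hn => ⟨(hinf.natEmbedding A n).2, hn⟩

theorem gammaAt_subset_seqLimitSets (x : T) : gammaAt x ⊆ seqLimitSets x := fun _ hA =>
  let ⟨b, _, hbA, hb⟩ := exists_injective_tendsto_of_mem_gammaAt hA
  ⟨b, hbA, hb⟩

theorem finite_preimage_singleton_of_tendsto [T1Space T] {b : ℕ → T} (h : Tendsto b atTop (𝓝 x))
    {y : T} (hy : y ≠ x) : (b ⁻¹' {y}).Finite := by
  rw [← Nat.cofinite_eq_atTop] at h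
  exact (eventually_cofinite.1 (h.eventually_ne hy.symm)).subset fun _ hn => not_not_intro hn

theorem range_mem_gammaAt [T1Space T] {b : ℕ → T} (h : Tendsto b atTop (𝓝 x))
    (hb : ∀ n, b n ≠ x) : range b ∈ gammaAt x := by
  refine ⟨infinite_range_of_finite_fibers fun n => finite_preimage_singleton_of_tendsto h (hb n),
    by simpa using hb, fun U hU => ?_⟩
  rw [← Nat.cofinite_eq_atTop] at h
  refine ((eventually_cofinite.1 (h.eventually hU)).image b).subset ?_
  rintro _ ⟨⟨n, rfl⟩, hn⟩
  exact mem_image_of_mem b hn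

theorem exists_tendsto_comp_of_mem_seqClosure_range [T1Space T] {b : ℕ → T} (hb : ∀ n, b n ≠ x)
    (hx : x ∈ seqClosure (range b)) :
    ∃ ν : ℕ → ℕ, Tendsto ν atTop atTop ∧ Tendsto (b ∘ ν) atTop (𝓝 x) := by
  obtain ⟨c, hcb, hc⟩ := hx
  choose ν hν using hcb
  obtain rfl : b ∘ ν = c := funext hν
  refine ⟨ν, ?_, hc⟩
  rw [← Nat.cofinite_eq_atTop]
  exact Tendsto.cofinite_of_finite_preimage_singleton fun n =>
    (finite_preimage_singleton_of_tendsto hc (hb n)).subset fun _ hk => congrArg b hk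

theorem SeqSeparable.of_S1 (h : S1 (seqDenseSets T) (seqDenseSets T)) : SeqSeparable T :=
  let ⟨b, _, hb⟩ := h (fun _ => univ) fun _ => univ_mem_seqDenseSets
  ⟨range b, countable_range b, hb⟩

end SequentialDensity

section DiagonalLimits

variable {T : Type u} [TopologicalSpace T]

variable (T) in
/-- Every iterated sequential limit in `T` is the limit of a diagonal sequence. -/
def DiagonalLimits : Prop :=
  ∀ (A : ℕ → ℕ → T) (f : ℕ → T) (x : T), (∀ n, Tendsto (A n) atTop (𝓝 (f n))) →
    Tendsto f atTop (𝓝 x) → ∃ σ : ℕ → ℕ, Tendsto (fun n => A n (σ n)) atTop (𝓝 x)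

theorem DiagonalLimits.S1_gammaAt_gammaAt [T1Space T] (h : DiagonalLimits T) (x : T) :
    S1 (gammaAt x) (gammaAt x) := by
  intro s hs
  choose A _ hAs hA using fun n => exists_injective_tendsto_of_mem_gammaAt (hs n)
  obtain ⟨σ, hσ⟩ := h A _ x hA tendsto_const_nhds
  exact ⟨fun n => A n (σ n), fun n => hAs n _,
    range_mem_gammaAt hσ fun n hn => (hs n).2.1 (hn ▸ hAs n (σ n))⟩

theorem DiagonalLimits.S1_seqDenseSets_gammaAt [T1Space T] (h : DiagonalLimits T) {x : T}
    {f : ℕ → T} (hfx : ∀ n, f n ≠ x) (hf : Tendsto f atTop (𝓝 x)) :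
    S1 (seqDenseSets T) (gammaAt x) := by
  intro s hs
  have hex (n : ℕ) : ∃ a : ℕ → T, (∀ m, a m ∈ s n ∧ a m ≠ x) ∧ Tendsto a atTop (𝓝 (f n)) := by
    obtain ⟨a, has, ha⟩ := mem_seqDenseSets_iff.1 (hs n) (f n)
    obtain ⟨k, hk⟩ := eventually_atTop.1 (ha.eventually_ne (hfx n))
    exact ⟨fun m => a (m + k), fun m => ⟨has _, hk _ (Nat.le_add_left k m)⟩,
      ha.comp (tendsto_add_atTop_nat k)⟩
  choose A hAs hA using hex
  obtain ⟨σ, hσ⟩ := h A f x hA hf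
  exact ⟨fun n => A n (σ n), fun n => (hAs n _).1, range_mem_gammaAt hσ fun n => (hAs n _).2⟩

theorem DiagonalLimits.S1_seqDenseSets_seqDenseSets [Nonempty T] (h : DiagonalLimits T)
    (hT : SeqSeparable T) : S1 (seqDenseSets T) (seqDenseSets T) := by
  intro s hs
  obtain ⟨D, hDc, hD⟩ := hT
  obtain ⟨t⟩ := ‹Nonempty T›
  obtain ⟨a, haD, -⟩ := mem_seqDenseSets_iff.1 hD t
  obtain ⟨d, rfl⟩ := hDc.exists_eq_range ⟨a 0, haD 0⟩
  choose A hAs hA using fun k n => mem_seqDenseSets_iff.1 (hs (Nat.pair k n)) (d k)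
  choose σ hσ using fun k => h (A k) _ (d k) (hA k) tendsto_const_nhds
  refine ⟨fun N => A N.unpair.1 N.unpair.2 (σ N.unpair.1 N.unpair.2),
    fun N => by simpa only [Nat.pair_unpair] using hAs N.unpair.1 N.unpair.2 _,
    mem_seqDenseSets_iff.2 fun x => ?_⟩
  obtain ⟨e, hed, he⟩ := mem_seqDenseSets_iff.1 hD x
  choose κ hκ using hed
  obtain ⟨τ, hτ⟩ := h _ _ x (fun i => hσ (κ i)) (by simpa only [hκ] using he)
  exact ⟨_, fun i => ⟨Nat.pair (κ i) (τ i), by simp only [Nat.unpair_pair]⟩, hτ⟩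

end DiagonalLimits

section FunctionSpace

variable {X : Type u} [TopologicalSpace X]

instance : Zero (Cp X) := ⟨⟨0, continuous_zero⟩⟩

theorem tendsto_Cp_iff {ι : Type*} {l : Filter ι} {b : ι → Cp X} {f : Cp X} :
    Tendsto b l (𝓝 f) ↔ ∀ x, Tendsto (fun i => (b i).1 x) l (𝓝 (f.1 x)) := by
  rw [tendsto_subtype_rng, tendsto_pi_nhds]

theorem exists_tendsto_Cp_ne [Nonempty X] (f : Cp X) :
    ∃ g : ℕ → Cp X, (∀ n, g n ≠ f) ∧ Tendsto g atTop (𝓝 f) := by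
  refine ⟨fun n => ⟨fun x => f.1 x + 1 / ((n : ℝ) + 1), f.2.add continuous_const⟩,
    fun n hn => ?_, tendsto_Cp_iff.2 fun x => ?_⟩
  · obtain ⟨x⟩ := ‹Nonempty X›
    have hx : f.1 x + 1 / ((n : ℝ) + 1) = f.1 x := congrFun (congrArg Subtype.val hn) x
    exact Nat.one_div_pos_of_nat.ne' (add_eq_left.1 hx)
  · simpa using tendsto_one_div_add_atTop_nhds_zero_nat.const_add (f.1 x)

end FunctionSpace

section GammaSequences

variable {X : Type u}

/-- A sequence of subsets of `X` such that each point belongs to all but finitely many of its terms: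
an indexed `γ`-cover, in which repetitions and the trivial set `X` are allowed. -/
def IsGammaSeq (U : ℕ → Set X) : Prop := ∀ x, ∀ᶠ n in atTop, x ∈ U n

theorem IsGammaSeq.isGammaCover_range {U : ℕ → Set X} (h : IsGammaSeq U) (hU : ∀ n, U n ≠ univ) :
    IsGammaCover (range U) := by
  have hfin (x : X) : {n | x ∉ U n}.Finite := by
    rw [← eventually_cofinite, Nat.cofinite_eq_atTop]
    exact h x
  refine ⟨eq_univ_of_forall fun x => ?_, by simpa using hU,
    infinite_range_of_finite_fibers fun n => ?_, fun x => ?_⟩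
  · obtain ⟨n, hn⟩ := (h x).exists
    exact ⟨U n, mem_range_self n, hn⟩
  · obtain ⟨x, hx⟩ := (ne_univ_iff_exists_notMem _).1 (hU n)
    exact (hfin x).subset fun k (hk : U k = U n) hxk => hx (hk ▸ hxk)
  · refine ((hfin x).image U).subset ?_
    rintro _ ⟨⟨n, rfl⟩, hn⟩
    exact mem_image_of_mem U hn

theorem IsGammaCover.isGammaSeq {𝒰 : Set (Set X)} (h : IsGammaCover 𝒰) {U : ℕ → Set X}
    (hU : Function.Injective U) (hmem : ∀ n, U n ∈ 𝒰) : IsGammaSeq U := fun x => by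
  rw [← Nat.cofinite_eq_atTop, eventually_cofinite]
  exact ((h.2.2.2 x).preimage hU.injOn).subset fun n hn => ⟨hmem n, hn⟩

theorem IsGammaCover.exists_isGammaSeq_comp {ι : Type*} {U : ι → Set X} {s : Set ι}
    (h : IsGammaCover (U '' s)) :
    ∃ ν : ℕ → ι, Function.Injective ν ∧ (∀ k, ν k ∈ s) ∧ IsGammaSeq (U ∘ ν) := by
  choose ν hνs hν using fun k => (h.2.2.1.natEmbedding _ k).2
  have hinj : Function.Injective (U ∘ ν) := by
    rw [show U ∘ ν = _ from funext hν]
    exact Subtype.val_injective.comp (h.2.2.1.natEmbedding _).injective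
  exact ⟨ν, hinj.of_comp, hνs, h.isGammaSeq hinj fun k => mem_image_of_mem U (hνs k)⟩

theorem IsGammaSeq.dissipate {U : ℕ → ℕ → Set X} (h : ∀ n, IsGammaSeq (U n)) (n : ℕ) :
    IsGammaSeq fun m => dissipate (U · m) n := fun x => by
  filter_upwards [(eventually_all_finite (finite_Iic n)).2 fun i _ => h i x] with m hm
  exact mem_dissipate.2 hm

theorem dissipate_induction {p : Set X → Prop} (hp : ∀ s t, p s → p t → p (s ∩ t))
    {s : ℕ → Set X} (hs : ∀ n, p (s n)) (n : ℕ) : p (dissipate s n) := by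
  induction n with
  | zero => simpa only [dissipate_zero_nat] using hs 0
  | succ n ih =>
    rw [dissipate_succ]
    exact hp _ _ ih (hs _)

/-- Passing to the decreasing intersections over `i ≤ n`, a selection along a sequence of indices
tending to infinity fills in to a selection from every `U n`. If all these intersections can be
chosen to be `X`, there is nothing to select; otherwise they differ from `X` from some `N` on. -/
theorem exists_isGammaSeq_of_dissipate {U : ℕ → ℕ → Set X}
    (h : ∀ N, (∀ n m, dissipate (U · m) (N + n) ≠ univ) → ∃ ν σ : ℕ → ℕ, Tendsto ν atTop atTop ∧
      IsGammaSeq fun k => dissipate (U · (σ k)) (N + ν k)) :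
    ∃ σ : ℕ → ℕ, IsGammaSeq fun n => U n (σ n) := by
  by_cases hfull : ∀ n, ∃ m, dissipate (U · m) n = univ
  · choose σ hσ using hfull
    exact ⟨σ, fun x => .of_forall fun n =>
      dissipate_subset (s := (U · (σ n))) le_rfl ((hσ n).symm ▸ mem_univ x)⟩
  push Not at hfull
  obtain ⟨N, hN⟩ := hfull
  obtain ⟨ν, σ, hν, hσ⟩ := h N fun n m =>
    ne_top_of_le_ne_top (hN m) (dissipate_subset_dissipate (Nat.le_add_right N n))
  choose κ hκ hνκ using fun n => ((eventually_ge_atTop n).and (hν.eventually_ge_atTop n)).exists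
  refine ⟨σ ∘ κ, fun x => ?_⟩
  filter_upwards [(tendsto_atTop_mono hκ tendsto_id).eventually (hσ x)] with n hn
  exact dissipate_subset ((hνκ n).trans (Nat.le_add_left _ N)) hn

end GammaSequences

section ZeroSets

variable {X : Type u} [TopologicalSpace X]

theorem isCozeroSet_iff {U : Set X} :
    IsCozeroSet U ↔ ∃ f : X → ℝ, Continuous f ∧ U = {x | f x ≠ 0} :=
  exists_congr fun _ => and_congr_right fun _ => compl_eq_comm.trans eq_comm

theorem IsCozeroSet.isOpen {U : Set X} (hU : IsCozeroSet U) : IsOpen U := by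
  obtain ⟨f, hf, rfl⟩ := isCozeroSet_iff.1 hU
  exact isOpen_ne_fun hf continuous_const

theorem isZeroSet_setOf_le {f g : X → ℝ} (hf : Continuous f) (hg : Continuous g) :
    IsZeroSet {x | f x ≤ g x} :=
  ⟨fun x => max (f x - g x) 0, (hf.sub hg).max continuous_const, by ext; simp⟩

theorem isCozeroSet_setOf_lt {f g : X → ℝ} (hf : Continuous f) (hg : Continuous g) :
    IsCozeroSet {x | f x < g x} := by
  simpa only [IsCozeroSet, compl_ofPred, not_lt] using isZeroSet_setOf_le hg hf

theorem isZeroSet_of_isClopen {U : Set X} (hU : IsClopen U) : IsZeroSet U :=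
  ⟨Uᶜ.indicator 1, hU.compl.continuous_indicator continuous_one, by ext; simp⟩

theorem IsZeroSet.inter {F G : Set X} (hF : IsZeroSet F) (hG : IsZeroSet G) :
    IsZeroSet (F ∩ G) := by
  obtain ⟨f, hf, rfl⟩ := hF
  obtain ⟨g, hg, rfl⟩ := hG
  refine ⟨fun x => |f x| + |g x|, hf.abs.add hg.abs, ?_⟩
  ext x
  change f x = 0 ∧ g x = 0 ↔ |f x| + |g x| = 0
  rw [add_eq_zero_iff_of_nonneg (abs_nonneg (f x)) (abs_nonneg (g x)), abs_eq_zero, abs_eq_zero]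

theorem IsCozeroSet.inter {U V : Set X} (hU : IsCozeroSet U) (hV : IsCozeroSet V) :
    IsCozeroSet (U ∩ V) := by
  obtain ⟨f, hf, rfl⟩ := isCozeroSet_iff.1 hU
  obtain ⟨g, hg, rfl⟩ := isCozeroSet_iff.1 hV
  refine isCozeroSet_iff.2 ⟨fun x => f x * g x, hf.mul hg, ?_⟩
  ext x
  simp

theorem IsZeroSet.exists_eqOn_zero_eqOn_one_compl {F U : Set X} (hF : IsZeroSet F)
    (hU : IsCozeroSet U) (hFU : F ⊆ U) :
    ∃ f : Cp X, EqOn f.1 0 F ∧ EqOn f.1 1 Uᶜ := by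
  obtain ⟨a, ha, rfl⟩ := hF
  obtain ⟨b, hb, rfl⟩ := isCozeroSet_iff.1 hU
  have hpos (x : X) : |a x| + |b x| ≠ 0 := fun h0 => by
    obtain ⟨hax, hbx⟩ := (add_eq_zero_iff_of_nonneg (abs_nonneg (a x)) (abs_nonneg (b x))).1 h0
    exact hFU (abs_eq_zero.1 hax) (abs_eq_zero.1 hbx)
  refine ⟨⟨fun x => |a x| / (|a x| + |b x|), ha.abs.div (ha.abs.add hb.abs) hpos⟩,
    fun x (hx : a x = 0) => by simp [hx], fun x hx => ?_⟩
  obtain hbx : b x = 0 := not_not.1 hx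
  simpa [hbx] using hpos x

end ZeroSets

section ShrinkableSelection

variable {X : Type u} [TopologicalSpace X]

variable (X) in
/-- The selection principle `S₁(Γ_F, Γ)` for indexed covers, without any nontriviality
requirement. -/
def ShrinkableSelection : Prop :=
  ∀ F U : ℕ → ℕ → Set X, (∀ n m, IsZeroSet (F n m)) → (∀ n m, IsCozeroSet (U n m)) →
    (∀ n m, F n m ⊆ U n m) → (∀ n, IsGammaSeq (F n)) → ∃ σ : ℕ → ℕ, IsGammaSeq fun n => U n (σ n)

theorem exists_tendsto_zero_eqOn_one_compl {F U : ℕ → Set X} (hF : ∀ m, IsZeroSet (F m))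
    (hU : ∀ m, IsCozeroSet (U m)) (hFU : ∀ m, F m ⊆ U m) (hγ : IsGammaSeq F) :
    ∃ g : ℕ → Cp X, Tendsto g atTop (𝓝 0) ∧ ∀ m, EqOn (g m).1 1 (U m)ᶜ := by
  choose g hg0 hg1 using fun m => (hF m).exists_eqOn_zero_eqOn_one_compl (hU m) (hFU m)
  refine ⟨g, tendsto_Cp_iff.2 fun x => tendsto_const_nhds.congr' ?_, hg1⟩
  filter_upwards [hγ x] with m hm using (hg0 m hm).symm

theorem ne_zero_of_eqOn_one_compl {b : Cp X} {U : Set X} (hb : EqOn b.1 1 Uᶜ) (hU : U ≠ univ) :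
    b ≠ 0 := by
  rintro rfl
  obtain ⟨x, hx⟩ := (ne_univ_iff_exists_notMem U).1 hU
  exact zero_ne_one (α := ℝ) (hb hx)

/-- A function equal to `1` off `U` and smaller than `1` at `x` certifies `x ∈ U`, so a sequence of
such functions converging to `0` selects a `γ`-sequence. -/
theorem ShrinkableSelection.of_S1 {𝒜 : Set (Set (Cp X))} (h : S1 𝒜 (seqLimitSets 0))
    (h𝒜 : ∀ (g : ℕ → Cp X) (U : ℕ → Set X), Tendsto g atTop (𝓝 0) →
      (∀ m, EqOn (g m).1 1 (U m)ᶜ) → (∀ m, U m ≠ univ) →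
        ∃ A ∈ 𝒜, ∀ b ∈ A, ∃ m, EqOn b.1 1 (U m)ᶜ) : ShrinkableSelection X := by
  intro F U hF hU hFU hγ
  refine exists_isGammaSeq_of_dissipate fun N hN => ?_
  choose g hg0 hg1 using fun n => exists_tendsto_zero_eqOn_one_compl
    (fun m => dissipate_induction (fun _ _ => IsZeroSet.inter) (hF · m) (N + n))
    (fun m => dissipate_induction (fun _ _ => IsCozeroSet.inter) (hU · m) (N + n))
    (fun m => iInter₂_mono fun i _ => hFU i m) (IsGammaSeq.dissipate hγ _)
  choose A hA𝒜 hA using fun n => h𝒜 (g n) _ (hg0 n) (hg1 n) (hN n)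
  obtain ⟨b, hbA, hb⟩ := h A hA𝒜
  choose σ hσ using fun n => hA n (b n) (hbA n)
  obtain ⟨ν, hν, hbν⟩ := exists_tendsto_comp_of_mem_seqClosure_range
    (fun n => ne_zero_of_eqOn_one_compl (hσ n) (hN n (σ n))) hb
  refine ⟨ν, σ ∘ ν, hν, fun x => ?_⟩
  filter_upwards [(tendsto_Cp_iff.1 hbν x).eventually_lt_const zero_lt_one] with k hk
  by_contra hx
  exact hk.ne (hσ (ν k) hx)

theorem ShrinkableSelection.of_S1_seqDenseSets (h : S1 (seqDenseSets (Cp X)) (seqLimitSets 0)) :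
    ShrinkableSelection X := by
  refine .of_S1 h fun g U hg hgU _ =>
    ⟨{b | ∃ m, EqOn b.1 1 (U m)ᶜ}, mem_seqDenseSets_iff.2 fun f => ?_, fun b hb => hb⟩
  refine ⟨fun m => ⟨fun x => f.1 x * (1 - (g m).1 x) + (g m).1 x,
    (f.2.mul (continuous_const.sub (g m).2)).add (g m).2⟩, fun m => ⟨m, fun x hx => ?_⟩,
    tendsto_Cp_iff.2 fun x => ?_⟩
  · simp [hgU m hx]
  · have hgx : Tendsto (fun m => (g m).1 x) atTop (𝓝 0) := tendsto_Cp_iff.1 hg x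
    simpa using ((hgx.const_sub 1).const_mul (f.1 x)).add hgx

theorem ShrinkableSelection.of_S1_gammaAt (h : S1 (gammaAt (0 : Cp X)) (seqLimitSets 0)) :
    ShrinkableSelection X := by
  refine .of_S1 h fun g U hg hgU hU => ⟨range g,
    range_mem_gammaAt hg fun m => ne_zero_of_eqOn_one_compl (hgU m) (hU m), ?_⟩
  rintro _ ⟨m, rfl⟩
  exact ⟨m, hgU m⟩

theorem ShrinkableSelection.S1_shrinkableGamma (h : ShrinkableSelection X) :
    S1 (shrinkableGamma X) (openGamma X) := by
  intro s hs
  choose hγ hcoz F hF hFγ using hs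
  choose U _ hUs hUγ using fun n => (hFγ n).exists_isGammaSeq_comp
  obtain ⟨σ, hσ⟩ := h (fun n m => F n (U n m)) U (fun n m => (hF n _ (hUs n m)).1)
    (fun n m => hcoz n _ (hUs n m)) (fun n m => (hF n _ (hUs n m)).2) hUγ
  refine ⟨fun n => U n (σ n), fun n => hUs n _,
    hσ.isGammaCover_range fun n hn => (hγ n).2.1 (hn ▸ hUs n (σ n)), ?_⟩
  rintro _ ⟨n, rfl⟩
  exact (hcoz n _ (hUs n _)).isOpen

end ShrinkableSelection

section ZeroDimensional

variable {X : Type u} [TopologicalSpace X]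

theorem exists_continuous_real_covering_cube :
    ∃ G : C(ℝ, ℕ → ℝ), univ.pi (fun _ => Icc 0 1) ⊆ G '' Icc 0 1 := by
  let _ : MetricSpace (ℕ → unitInterval) := TopologicalSpace.metrizableSpaceMetric _
  obtain ⟨q, hq, hq_surj⟩ := exists_nat_bool_continuous_surjective_of_compact (ℕ → unitInterval)
  let F : C(cantorSet, ℕ → ℝ) := ⟨fun c n => q (cantorSetHomeomorphNatToBool c) n, by fun_prop⟩
  obtain ⟨G, hG⟩ := ContinuousMap.exists_restrict_eq isClosed_cantorSet F
  refine ⟨G, fun t ht => ?_⟩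
  obtain ⟨a, ha⟩ := hq_surj fun n => ⟨t n, ht n trivial⟩
  have hGa : G (cantorSetHomeomorphNatToBool.symm a) = F _ := DFunLike.congr_fun hG _
  refine ⟨_, cantorSet_subset_unitInterval (cantorSetHomeomorphNatToBool.symm a).2, ?_⟩
  ext n
  simp [hGa, F, ha]

theorem eventually_one_le_abs_mul_sub_one (t : ℝ) :
    ∀ᶠ m : ℕ in atTop, 1 ≤ |((m : ℝ) + 1) * t - 1| := by
  rcases le_or_gt t 0 with ht | ht
  · refine .of_forall fun m => le_abs.2 (.inr ?_)
    linarith [mul_nonpos_of_nonneg_of_nonpos (by positivity : 0 ≤ (m : ℝ) + 1) ht]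
  · have hlim : Tendsto (fun m : ℕ => ((m : ℝ) + 1) * t) atTop atTop :=
      (tendsto_atTop_add_const_right _ _ tendsto_natCast_atTop_atTop).atTop_mul_const ht
    filter_upwards [hlim.eventually_ge_atTop 2] with m hm
    exact le_abs.2 (.inl (by linarith))

/-- If `f` took all values in `[0, 1]`, then composing with a Peano curve would realise every
sequence `n ↦ 1 / (σ n + 1)` at some point of `X`, and that point defeats the selection `σ` from
the sets `{(m + 1) t n ≠ 1}`. -/
theorem ShrinkableSelection.not_Icc_subset_range (h : ShrinkableSelection X) {f : X → ℝ}
    (hf : Continuous f) : ¬ Icc 0 1 ⊆ range f := by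
  intro hcov
  obtain ⟨G, hG⟩ := exists_continuous_real_covering_cube
  have hcont (n m : ℕ) : Continuous fun x => ((m : ℝ) + 1) * G (f x) n - 1 := by fun_prop
  obtain ⟨σ, hσ⟩ := h (fun n m => {x | 1 ≤ |((m : ℝ) + 1) * G (f x) n - 1|})
    (fun n m => {x | ((m : ℝ) + 1) * G (f x) n - 1 ≠ 0})
    (fun n m => isZeroSet_setOf_le continuous_const (hcont n m).abs)
    (fun n m => isCozeroSet_iff.2 ⟨_, hcont n m, rfl⟩)
    (fun n m x hx => abs_pos.1 (zero_lt_one.trans_le hx))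
    (fun n x => eventually_one_le_abs_mul_sub_one _)
  obtain ⟨c, hc, hGc⟩ := hG (show (fun n => 1 / ((σ n : ℝ) + 1)) ∈ univ.pi fun _ => Icc 0 1 from
    fun n _ => ⟨by positivity, div_le_one_of_le₀ (by simp) (by positivity)⟩)
  obtain ⟨x, rfl⟩ := hcov hc
  obtain ⟨n, hn⟩ := (hσ x).exists
  refine hn ?_
  rw [hGc, mul_one_div_cancel (by positivity), sub_self]

theorem ShrinkableSelection.dense_compl_range (h : ShrinkableSelection X) {f : X → ℝ}
    (hf : Continuous f) : Dense (range f)ᶜ := by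
  refine dense_of_exists_between fun {a b} hab => ?_
  obtain ⟨c, ⟨hc0, hc1⟩, hcf⟩ := not_subset.1 <| h.not_Icc_subset_range
    (f := fun x => 3 * (f x - a) / (b - a) - 1) (by fun_prop)
  have : 0 < b - a := sub_pos.2 hab
  refine ⟨a + (c + 1) / 3 * (b - a), ?_, ?_, ?_⟩
  · rintro ⟨x, hx⟩
    refine hcf ⟨x, ?_⟩
    simp only [hx]
    field_simp
    ring
  · exact lt_add_of_pos_right a (by positivity)
  · nlinarith

theorem isClopen_setOf_lt_of_notMem_range {f : X → ℝ} (hf : Continuous f) {c : ℝ}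
    (hc : c ∉ range f) : IsClopen {x | c < f x} := by
  have heq : {x | c < f x} = {x | c ≤ f x} := by
    ext x
    exact (Ne.le_iff_lt fun hx => hc ⟨x, hx.symm⟩).symm
  exact ⟨heq ▸ isClosed_le continuous_const hf, isOpen_lt continuous_const hf⟩

theorem StronglyZeroDimensional.of_clopen_refinement
    (h : ∀ (n : ℕ) (U : Fin n → Set X), (∀ i, IsCozeroSet (U i)) → ⋃ i, U i = univ →
      ∃ W : Fin n → Set X, (∀ i, IsClopen (W i)) ∧ (∀ i, W i ⊆ U i) ∧ ⋃ i, W i = univ) :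
    StronglyZeroDimensional X := by
  intro n U hU hcov
  obtain ⟨W, hW, hWU, hWcov⟩ := h n U hU hcov
  exact ⟨n, disjointed W, fun i => (disjointedRec (fun _ j ht => ht.diff (hW j)) (hW i)).isOpen,
    fun i => ⟨i, (disjointed_subset W i).trans (hWU i)⟩, iUnion_disjointed.trans hWcov,
    disjoint_disjointed W⟩

/-- Cut each function `p i` of a partition of unity carried by the `U i` at a value in `(0, 1 / n)`
that it omits: as the `p i` sum up to `1`, one of them is above its cut at each point. -/
theorem StronglyZeroDimensional.of_dense_compl_range
    (h : ∀ f : X → ℝ, Continuous f → Dense (range f)ᶜ) : StronglyZeroDimensional X := by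
  refine of_clopen_refinement fun n U hU hcov => ?_
  choose f hf hfU using fun i => isCozeroSet_iff.1 (hU i)
  have hpos (x : X) : 0 < ∑ i, |f i x| := by
    obtain ⟨i, hi⟩ := iUnion_eq_univ_iff.1 hcov x
    rw [hfU] at hi
    exact Finset.sum_pos' (fun _ _ => abs_nonneg _) ⟨i, Finset.mem_univ i, abs_pos.2 hi⟩
  set p : Fin n → X → ℝ := fun i x => |f i x| / ∑ j, |f j x| with hp
  have hpc (i : Fin n) : Continuous (p i) :=
    (hf i).abs.div (continuous_finsetSum _ fun j _ => (hf j).abs) fun x => (hpos x).ne'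
  have hpsum (x : X) : ∑ i, p i x = 1 := by
    rw [hp, ← Finset.sum_div, div_self (hpos x).ne']
  have hn (i : Fin n) : (0 : ℝ) < 1 / n := one_div_pos.2 (Nat.cast_pos.2 i.pos)
  choose c hcp hc using fun i => (h (p i) (hpc i)).exists_between (hn i)
  refine ⟨fun i => {x | c i < p i x}, fun i => isClopen_setOf_lt_of_notMem_range (hpc i) (hcp i),
    fun i x hx => ?_, eq_univ_of_forall fun x => ?_⟩
  · rw [hfU]
    rintro (hfx : f i x = 0)
    exact ((hc i).1.trans hx).ne' (by simp [hp, hfx])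
  · by_contra! hx
    simp only [mem_iUnion, mem_ofPred_eq, not_exists, not_lt] at hx
    obtain ⟨i, -⟩ := iUnion_eq_univ_iff.1 hcov x
    have hlt : ∑ i, p i x < ∑ _i : Fin n, (1 / n : ℝ) :=
      Finset.sum_lt_sum_of_nonempty ⟨i, Finset.mem_univ i⟩ fun i _ => (hx i).trans_lt (hc i).2
    have hn0 : (n : ℝ) ≠ 0 := Nat.cast_ne_zero.2 i.pos.ne'
    simp [hpsum, hn0] at hlt

theorem ShrinkableSelection.stronglyZeroDimensional (h : ShrinkableSelection X) :
    StronglyZeroDimensional X :=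
  .of_dense_compl_range fun _ hf => h.dense_compl_range hf

theorem StronglyZeroDimensional.exists_isClopen_between (h : StronglyZeroDimensional X)
    {F U : Set X} (hF : IsZeroSet F) (hU : IsCozeroSet U) (hFU : F ⊆ U) :
    ∃ W, IsClopen W ∧ F ⊆ W ∧ W ⊆ U := by
  obtain ⟨m, V, hVo, hVU, hVcov, hVd⟩ := h 2 ![U, Fᶜ]
    (Fin.forall_fin_two.2 ⟨hU, by simpa [IsCozeroSet] using hF⟩)
    (eq_univ_of_forall fun x => mem_iUnion.2 <| by
      by_cases hx : x ∈ F
      exacts [⟨0, hFU hx⟩, ⟨1, hx⟩])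
  refine ⟨⋃ j ∈ {j | V j ⊆ U}, V j, ⟨?_, isOpen_biUnion fun j _ => hVo j⟩, fun x hx => ?_,
    iUnion₂_subset fun j hj => hj⟩
  · rw [← isOpen_compl_iff, biUnion_compl_eq_of_pairwise_disjoint_of_iUnion_eq_univ hVcov hVd]
    exact isOpen_biUnion fun j _ => hVo j
  · obtain ⟨j, hj⟩ := iUnion_eq_univ_iff.1 hVcov x
    refine mem_biUnion (x := j) ?_ hj
    rcases Fin.exists_fin_two.1 (hVU j) with hjU | hjF
    exacts [hjU, absurd hx (hjF hj)]

end ZeroDimensional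

section ClopenSelection

variable {X : Type u} [TopologicalSpace X]

theorem S1_clopenGamma_of_S1_shrinkableGamma (h : S1 (shrinkableGamma X) (openGamma X)) :
    S1 (clopenGamma X) (clopenGamma X) := by
  intro s hs
  have hzero {n : ℕ} {U : Set X} (hU : U ∈ s n) : IsZeroSet U :=
    isZeroSet_of_isClopen ((hs n).2 U hU)
  have hcozero {n : ℕ} {U : Set X} (hU : U ∈ s n) : IsCozeroSet U :=
    isZeroSet_of_isClopen ((hs n).2 U hU).compl
  obtain ⟨b, hbs, hb⟩ := h s fun n => ⟨(hs n).1, fun U => hcozero, id,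
    fun U hU => ⟨hzero hU, Subset.rfl⟩, by simpa only [image_id] using (hs n).1⟩
  exact ⟨b, hbs, hb.1, forall_mem_range.2 fun n => (hs n).2 _ (hbs n)⟩

theorem exists_isGammaSeq_of_S1_clopenGamma (h : S1 (clopenGamma X) (clopenGamma X))
    {U : ℕ → ℕ → Set X} (hU : ∀ n m, IsClopen (U n m)) (hγ : ∀ n, IsGammaSeq (U n)) :
    ∃ σ : ℕ → ℕ, IsGammaSeq fun n => U n (σ n) := by
  refine exists_isGammaSeq_of_dissipate fun N hN => ?_
  obtain ⟨W, hW, hWγ, -⟩ := h (fun n => range fun m => dissipate (U · m) (N + n)) fun n =>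
    ⟨(IsGammaSeq.dissipate hγ _).isGammaCover_range (hN n), forall_mem_range.2 fun m =>
      dissipate_induction (fun _ _ => IsClopen.inter) (hU · m) _⟩
  choose σ hσ using hW
  rw [← image_univ] at hWγ
  obtain ⟨ν, hν, -, hWν⟩ := hWγ.exists_isGammaSeq_comp
  refine ⟨ν, σ ∘ ν, hν.nat_tendsto_atTop, ?_⟩
  simpa only [Function.comp_def, hσ] using hWν

theorem diagonalLimits_Cp_of_S1_clopenGamma (h : S1 (clopenGamma X) (clopenGamma X))
    (hX : StronglyZeroDimensional X) : DiagonalLimits (Cp X) := by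
  intro A f F hA hf
  have hdiff (n m : ℕ) : Continuous fun x => |(A n m).1 x - (f n).1 x| :=
    ((A n m).2.sub (f n).2).abs
  have hε (n : ℕ) : (0 : ℝ) < 1 / (n + 1) := Nat.one_div_pos_of_nat
  choose W hW hFW hWU using fun n m => hX.exists_isClopen_between
    (isZeroSet_setOf_le (hdiff n m) (continuous_const (y := 1 / ((n : ℝ) + 1) / 2)))
    (isCozeroSet_setOf_lt (hdiff n m) (continuous_const (y := 1 / ((n : ℝ) + 1))))
    fun x hx => lt_of_le_of_lt hx (half_lt_self (hε n))
  have hγ (n : ℕ) : IsGammaSeq (W n) := fun x => by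
    have hx : Tendsto (fun m => |(A n m).1 x - (f n).1 x|) atTop (𝓝 0) := by
      simpa using ((tendsto_Cp_iff.1 (hA n) x).sub_const ((f n).1 x)).abs
    filter_upwards [hx.eventually_le_const (half_pos (hε n))] with m hm using hFW n m hm
  obtain ⟨σ, hσ⟩ := exists_isGammaSeq_of_S1_clopenGamma h hW hγ
  refine ⟨σ, tendsto_Cp_iff.2 fun x => ?_⟩
  have hx : Tendsto (fun n => (A n (σ n)).1 x - (f n).1 x) atTop (𝓝 0) := by
    refine squeeze_zero_norm' ?_ tendsto_one_div_add_atTop_nhds_zero_nat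
    filter_upwards [hσ x] with n hn using (hWU n _ hn).le
  simpa using hx.add (tendsto_Cp_iff.1 hf x)

end ClopenSelection

section BaireOne

variable {X K : Type*} [TopologicalSpace K] {ψ : X → K} {f g : X → ℝ}

/-- `g` is a pointwise limit of continuous functions on `K` pulled back along `ψ`. For `ψ = id`
these are the functions of the first Baire class. -/
def BaireOneAlong (ψ : X → K) (g : X → ℝ) : Prop :=
  ∃ h : ℕ → C(K, ℝ), ∀ x, Tendsto (fun m => h m (ψ x)) atTop (𝓝 (g x))

theorem BaireOneAlong.add (hf : BaireOneAlong ψ f) (hg : BaireOneAlong ψ g) :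
    BaireOneAlong ψ (f + g) :=
  let ⟨u, hu⟩ := hf
  let ⟨v, hv⟩ := hg
  ⟨u + v, fun x => (hu x).add (hv x)⟩

theorem BaireOneAlong.sub (hf : BaireOneAlong ψ f) (hg : BaireOneAlong ψ g) :
    BaireOneAlong ψ (f - g) :=
  let ⟨u, hu⟩ := hf
  let ⟨v, hv⟩ := hg
  ⟨u - v, fun x => (hu x).sub (hv x)⟩

theorem BaireOneAlong.exists_norm_le (hg : BaireOneAlong ψ g) {r : ℝ} (hr : 0 ≤ r)
    (hgr : ∀ x, ‖g x‖ ≤ r) : ∃ h : ℕ → C(K, ℝ), (∀ m y, ‖h m y‖ ≤ r) ∧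
      ∀ x, Tendsto (fun m => h m (ψ x)) atTop (𝓝 (g x)) := by
  obtain ⟨h, hh⟩ := hg
  refine ⟨fun m => ⟨fun y => max (-r) (min (h m y) r), by fun_prop⟩, fun m y => ?_, fun x => ?_⟩
  · exact abs_le.2 ⟨le_max_left _ _, max_le (neg_le_self hr) (min_le_right _ _)⟩
  · obtain ⟨hl, hu⟩ := abs_le.1 (hgr x)
    have hgx : max (-r) (min (g x) r) = g x := by rw [min_eq_left hu, max_eq_right hl]
    simpa only [hgx, ContinuousMap.coe_mk] using
      (tendsto_const_nhds (x := -r)).max ((hh x).min (tendsto_const_nhds (x := r)))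

theorem BaireOneAlong.tsum {g : ℕ → X → ℝ} (hg : ∀ i, BaireOneAlong ψ (g i)) {r : ℕ → ℝ}
    (hr : Summable r) (hr0 : ∀ i, 0 ≤ r i) (hgr : ∀ i x, ‖g i x‖ ≤ r i) :
    BaireOneAlong ψ fun x => ∑' i, g i x := by
  choose h hhr hh using fun i => (hg i).exists_norm_le (hr0 i) (hgr i)
  exact ⟨fun m => ⟨fun y => ∑' i, h i m y,
      continuous_tsum (fun i => (h i m).continuous) hr fun i => hhr i m⟩,
    fun x => tendsto_tsum_of_dominated_convergence hr (fun i => hh i x)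
      (.of_forall fun m i => hhr i m _)⟩

theorem BaireOneAlong.of_forall_exists_dist_le
    (h : ∀ ε > 0, ∃ g, BaireOneAlong ψ g ∧ ∀ x, dist (g x) (f x) ≤ ε) : BaireOneAlong ψ f := by
  choose g hg hgf using fun i : ℕ => h ((1 / 2) ^ i) (by positivity)
  have hlim (x : X) : Tendsto (fun i => g i x) atTop (𝓝 (f x)) :=
    tendsto_iff_dist_tendsto_zero.2 <| squeeze_zero (fun _ => dist_nonneg) (hgf · x)
      (tendsto_pow_atTop_nhds_zero_of_lt_one (by norm_num) (by norm_num))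
  have hbound (i : ℕ) (x : X) : ‖(g (i + 1) - g i) x‖ ≤ 2 * (1 / 2) ^ i := by
    have hpow : (1 / 2 : ℝ) ^ (i + 1) ≤ (1 / 2) ^ i :=
      pow_le_pow_of_le_one (by norm_num) (by norm_num) i.le_succ
    rw [Pi.sub_apply, ← dist_eq_norm]
    linarith [dist_triangle_right (g (i + 1) x) (g i x) (f x), hgf (i + 1) x, hgf i x]
  have hsummable : Summable fun i : ℕ => 2 * (1 / 2 : ℝ) ^ i := summable_geometric_two.mul_left 2
  have htsum (x : X) : ∑' i, (g (i + 1) - g i) x = f x - g 0 x :=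
    ((hsummable.of_norm_bounded (hbound · x)).hasSum_iff_tendsto_nat.2 <| by
      simpa only [Pi.sub_apply, Finset.sum_range_sub fun i => g i x] using
        (hlim x).sub_const (g 0 x)).tsum_eq
  convert (hg 0).add (.tsum (fun i => (hg (i + 1)).sub (hg i)) hsummable (by simp) hbound) using 1
  ext x
  rw [Pi.add_apply, htsum, add_sub_cancel]

/-- If `p k m → 1_{C k}` as `m → ∞` and `p k m = 1` on `C k`, then the functions
`∑ k < m, c k * p k m * ∏ j < k, (1 - p j m)`, pulled back along `ψ`, converge to `f`. -/
theorem BaireOneAlong.of_forall_exists_first_mem [HasOuterApproxClosed K] {C : ℕ → Set K}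
    (hC : ∀ k, IsClosed (C k)) {c : ℕ → ℝ}
    (hf : ∀ x, ∃ k, ψ x ∈ C k ∧ (∀ j < k, ψ x ∉ C j) ∧ f x = c k) : BaireOneAlong ψ f := by
  let p (k m : ℕ) (y : K) : ℝ := (hC k).apprSeq m y
  let t (k m : ℕ) (y : K) : ℝ := c k * p k m y * ∏ j ∈ Finset.range k, (1 - p j m y)
  refine ⟨fun m => ⟨fun y => ∑ k ∈ Finset.range m, t k m y, by fun_prop⟩, fun x => ?_⟩
  obtain ⟨n, hn, hlt, hfx⟩ := hf x
  have hp (k : ℕ) : Tendsto (p k · (ψ x)) atTop (𝓝 ((C k).indicator 1 (ψ x))) := by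
    have := tendsto_pi_nhds.1 (HasOuterApproxClosed.tendsto_apprSeq (hC k)) (ψ x)
    rw [show (C k).indicator 1 (ψ x) = (((C k).indicator (fun _ => 1) (ψ x) : NNReal) : ℝ) by
      by_cases hx : ψ x ∈ C k <;> simp [hx]]
    exact NNReal.tendsto_coe.2 this
  have hprod (k : ℕ) (hk : k ≤ n) :
      Tendsto (fun m => ∏ j ∈ Finset.range k, (1 - p j m (ψ x))) atTop (𝓝 1) := by
    rw [← Finset.prod_const_one (s := Finset.range k)]
    refine tendsto_finsetProd _ fun j hj => ?_
    simpa [hlt j ((Finset.mem_range.1 hj).trans_le hk)] using (hp j).const_sub 1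
  have hhead : Tendsto (fun m => ∑ k ∈ Finset.range n, t k m (ψ x)) atTop (𝓝 0) := by
    rw [← Finset.sum_const_zero (s := Finset.range n)]
    refine tendsto_finsetSum _ fun k hk => ?_
    have hk := Finset.mem_range.1 hk
    simpa [hlt k hk] using ((hp k).const_mul (c k)).mul (hprod k hk.le)
  have hlast : Tendsto (fun m => t n m (ψ x)) atTop (𝓝 (f x)) := by
    simpa [hn, hfx] using ((hp n).const_mul (c n)).mul (hprod n le_rfl)
  have htail (k m : ℕ) (hk : n < k) : t k m (ψ x) = 0 := by
    refine mul_eq_zero_of_right _ (Finset.prod_eq_zero (Finset.mem_range.2 hk) ?_)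
    simp [p, HasOuterApproxClosed.apprSeq_apply_eq_one (hC n) m hn]
  rw [← zero_add (f x)]
  refine (hhead.add hlast).congr' ?_
  filter_upwards [eventually_gt_atTop n] with m hm
  rw [← Finset.sum_range_succ]
  exact Finset.sum_subset (Finset.range_mono hm) fun k _ hk =>
    htail k m (by simpa using hk)

/-- The Lebesgue–Hausdorff theorem: within `ε`, `f` is the step function taking at `x` the value `q`
from the first closed piece of some `f ⁻¹' (q - ε, q + ε)`, `q` rational, that contains `x`. -/
theorem BaireOneAlong.of_isFsigma_preimage [HasOuterApproxClosed K]
    (h : ∀ a b, ∃ S : Set K, IsFsigma S ∧ ψ ⁻¹' S = f ⁻¹' Ioo a b) : BaireOneAlong ψ f := by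
  classical
  refine .of_forall_exists_dist_le fun ε hε => ?_
  choose S hS hSf using fun q : ℚ => h (q - ε) (q + ε)
  choose F hF hSF using hS
  obtain ⟨e, he⟩ := exists_surjective_nat (ℚ × ℕ)
  have hmem (q : ℚ) (x : X) : dist (q : ℝ) (f x) < ε ↔ ∃ n, ψ x ∈ F q n := by
    rw [← mem_iUnion, ← hSF, ← mem_preimage, hSf, ← Real.ball_eq_Ioo, mem_preimage,
      Metric.mem_ball']
  have hcov (x : X) : ∃ k, ψ x ∈ F (e k).1 (e k).2 := by
    obtain ⟨q, hq⟩ := Rat.denseRange_cast.exists_dist_lt (f x) hε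
    obtain ⟨n, hn⟩ := (hmem q x).1 (by rwa [dist_comm])
    obtain ⟨k, hk⟩ := he (q, n)
    exact ⟨k, by rwa [hk]⟩
  exact ⟨fun x => (e (Nat.find (hcov x))).1, .of_forall_exists_first_mem (fun _ => hF _ _)
      (c := fun k => (e k).1) fun x => ⟨_, Nat.find_spec (hcov x), fun _ => Nat.find_min _, rfl⟩,
    fun x => ((hmem _ x).2 ⟨_, Nat.find_spec (hcov x)⟩).le⟩

end BaireOne

section Velichko

variable {X : Type u} [TopologicalSpace X]

theorem setOf_ne_zero_eq_iUnion_iInter {α : Type*} {u : ℕ → α → ℝ} {f : α → ℝ}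
    (h : ∀ x, Tendsto (fun n => u n x) atTop (𝓝 (f x))) :
    {x | f x ≠ 0} = ⋃ k : ℕ, ⋂ n ≥ k, {x | 1 / ((k : ℝ) + 1) ≤ |u n x|} := by
  ext x
  simp only [mem_ofPred_eq, mem_iUnion, mem_iInter]
  constructor
  · intro hx
    have hu : ∀ᶠ n in atTop, |f x| / 2 < |u n x| :=
      (h x).abs.eventually_const_lt (half_lt_self (abs_pos.2 hx))
    have hsmall : ∀ᶠ k : ℕ in atTop, 1 / ((k : ℝ) + 1) < |f x| / 2 :=
      tendsto_one_div_add_atTop_nhds_zero_nat.eventually_lt_const (by positivity)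
    obtain ⟨k, hk, hk'⟩ := ((eventually_forall_ge_atTop.2 hu).and hsmall).exists
    exact ⟨k, fun n hn => (hk'.trans (hk n hn)).le⟩
  · rintro ⟨k, hk⟩
    have hle : 1 / ((k : ℝ) + 1) ≤ |f x| :=
      ge_of_tendsto (h x).abs (eventually_atTop.2 ⟨k, hk⟩)
    exact abs_pos.1 (Nat.one_div_pos_of_nat.trans_le hle)

theorem injective_eval_of_mem_seqDenseSets [T35Space X] {D : Set (Cp X)}
    (hD : D ∈ seqDenseSets (Cp X)) : Function.Injective fun (x : X) (d : D) => d.1.1 x := by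
  intro x y hxy
  by_contra hne
  obtain ⟨f, hf, hfx, hfy⟩ :=
    CompletelyRegularSpace.completely_regular x {y} isClosed_singleton hne
  obtain ⟨d, hdD, hd⟩ :=
    mem_seqDenseSets_iff.1 hD ⟨fun x => f x, continuous_subtype_val.comp hf⟩
  rw [tendsto_Cp_iff] at hd
  have hfxy : (f x : ℝ) = f y := tendsto_nhds_unique (hd x) <|
    (hd y).congr fun n => (congrFun hxy ⟨d n, hdD n⟩).symm
  rw [hfx, hfy rfl] at hfxy
  exact zero_ne_one hfxy

theorem SeqSeparable.propertyV [T35Space X] (h : SeqSeparable (Cp X)) : PropertyV X := by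
  obtain ⟨D, hDc, hD⟩ := h
  have := hDc.to_subtype
  let eval : X → D → ℝ := fun x d => d.1.1 x
  let _ : MetricSpace (range eval) := TopologicalSpace.metrizableSpaceMetric _
  refine ⟨range eval, inferInstance, inferInstance, rangeFactorization eval,
    (continuous_pi fun d => d.1.2).subtype_mk _,
    ⟨fun x y hxy => injective_eval_of_mem_seqDenseSets hD (congrArg Subtype.val hxy),
      rangeFactorization_surjective⟩, fun U hU => ?_⟩
  obtain ⟨f, hf, rfl⟩ := isCozeroSet_iff.1 hU
  obtain ⟨u, huD, hu⟩ := mem_seqDenseSets_iff.1 hD ⟨f, hf⟩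
  refine ⟨fun k => ⋂ n ≥ k, {y | 1 / ((k : ℝ) + 1) ≤ |y.1 ⟨u n, huD n⟩|},
    fun k => isClosed_biInter fun n _ => isClosed_le continuous_const
      ((continuous_apply _).comp continuous_subtype_val).abs, ?_⟩
  rw [setOf_ne_zero_eq_iUnion_iInter (tendsto_Cp_iff.1 hu),
    ← rangeFactorization_surjective.image_preimage (⋃ k, _)]
  simp only [preimage_iUnion, preimage_iInter]
  rfl

theorem PropertyV.exists_continuous_hilbertCube (h : PropertyV X) :
    ∃ ψ : X → ℕ → unitInterval, Continuous ψ ∧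
      ∀ U, IsCozeroSet U → ∃ S, IsFsigma S ∧ ψ ⁻¹' S = U := by
  obtain ⟨Y, _, _, φ, hφ, hbij, hFσ⟩ := h
  obtain ⟨e, he⟩ := Metric.PiNatEmbed.exists_embedding_to_hilbert_cube (X := Y)
  refine ⟨e ∘ φ, he.continuous.comp hφ, fun U hU => ?_⟩
  obtain ⟨F, hF, hUF⟩ := hFσ U hU
  choose C hC hCF using fun n => he.isInducing.isClosed_iff.1 (hF n)
  refine ⟨⋃ n, C n, ⟨C, hC, rfl⟩, ?_⟩
  rw [preimage_comp, preimage_iUnion, iUnion_congr hCF, ← hUF, hbij.1.preimage_image]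

theorem seqSeparable_Cp_of_baireOneAlong {K : Type*} [TopologicalSpace K] [CompactSpace K]
    [TopologicalSpace.SeparableSpace C(K, ℝ)] {ψ : X → K} (hψ : Continuous ψ)
    (h : ∀ f : Cp X, BaireOneAlong ψ f.1) : SeqSeparable (Cp X) := by
  refine ⟨range fun n => ⟨TopologicalSpace.denseSeq C(K, ℝ) n ∘ ψ, by fun_prop⟩,
    countable_range _, mem_seqDenseSets_iff.2 fun f => ?_⟩
  obtain ⟨u, hu⟩ := h f
  choose n hn using fun m : ℕ => (TopologicalSpace.denseRange_denseSeq C(K, ℝ)).exists_dist_lt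
    (u m) (Nat.one_div_pos_of_nat (α := ℝ) (n := m))
  refine ⟨_, fun m => mem_range_self (n m), tendsto_Cp_iff.2 fun x => ?_⟩
  refine (tendsto_iff_of_dist ?_).1 (hu x)
  exact squeeze_zero (fun _ => dist_nonneg)
    (fun m => (ContinuousMap.dist_apply_le_dist (ψ x)).trans (hn m).le)
    tendsto_one_div_add_atTop_nhds_zero_nat

theorem PropertyV.seqSeparable (h : PropertyV X) : SeqSeparable (Cp X) := by
  obtain ⟨ψ, hψ, hFσ⟩ := h.exists_continuous_hilbertCube
  refine seqSeparable_Cp_of_baireOneAlong hψ fun f => .of_isFsigma_preimage fun a b => hFσ _ ?_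
  exact (isCozeroSet_setOf_lt continuous_const f.2).inter
    (isCozeroSet_setOf_lt f.2 continuous_const)

theorem seqSeparable_Cp_iff_propertyV [T35Space X] : SeqSeparable (Cp X) ↔ PropertyV X :=
  ⟨SeqSeparable.propertyV, PropertyV.seqSeparable⟩

end Velichko

end SelCp

theorem mainTheorem4 (X : Type u) [TopologicalSpace X] [T35Space X] [Nonempty X] :
    List.TFAE [
      SelCp.S1 (SelCp.seqDenseSets (SelCp.Cp X)) (SelCp.seqDenseSets (SelCp.Cp X)),
      SelCp.S1 (SelCp.shrinkableGamma X) (SelCp.openGamma X) ∧ SelCp.PropertyV X ∧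
        SelCp.StronglyZeroDimensional X,
      SelCp.S1 (SelCp.clopenGamma X) (SelCp.clopenGamma X) ∧ SelCp.PropertyV X ∧
        SelCp.StronglyZeroDimensional X,
      (∀ f : SelCp.Cp X, SelCp.S1 (SelCp.gammaAt f) (SelCp.gammaAt f)) ∧
        SelCp.SeqSeparable (SelCp.Cp X),
      (∀ f : SelCp.Cp X, SelCp.S1 (SelCp.seqDenseSets (SelCp.Cp X)) (SelCp.gammaAt f)) ∧
        SelCp.SeqSeparable (SelCp.Cp X)] := by
  have toCovers (h : SelCp.ShrinkableSelection X) (hs : SelCp.SeqSeparable (SelCp.Cp X)) :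
      SelCp.S1 (SelCp.shrinkableGamma X) (SelCp.openGamma X) ∧ SelCp.PropertyV X ∧
        SelCp.StronglyZeroDimensional X :=
    ⟨h.S1_shrinkableGamma, SelCp.seqSeparable_Cp_iff_propertyV.1 hs, h.stronglyZeroDimensional⟩
  have ofCovers (h : SelCp.S1 (SelCp.clopenGamma X) (SelCp.clopenGamma X) ∧ SelCp.PropertyV X ∧
      SelCp.StronglyZeroDimensional X) :
      SelCp.DiagonalLimits (SelCp.Cp X) ∧ SelCp.SeqSeparable (SelCp.Cp X) :=
    ⟨SelCp.diagonalLimits_Cp_of_S1_clopenGamma h.1 h.2.2,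
      SelCp.seqSeparable_Cp_iff_propertyV.2 h.2.1⟩
  tfae_have 1 → 2 := fun h => toCovers
    (.of_S1_seqDenseSets (h.mono subset_rfl (SelCp.seqDenseSets_subset_seqLimitSets 0))) (.of_S1 h)
  tfae_have 4 → 2 := fun h => toCovers
    (.of_S1_gammaAt ((h.1 0).mono subset_rfl (SelCp.gammaAt_subset_seqLimitSets 0))) h.2
  tfae_have 5 → 2 := fun h => toCovers
    (.of_S1_seqDenseSets ((h.1 0).mono subset_rfl (SelCp.gammaAt_subset_seqLimitSets 0))) h.2
  tfae_have 2 → 3 := fun h => ⟨SelCp.S1_clopenGamma_of_S1_shrinkableGamma h.1, h.2⟩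
  tfae_have 3 → 1 := fun h => (ofCovers h).1.S1_seqDenseSets_seqDenseSets (ofCovers h).2
  tfae_have 3 → 4 := fun h => ⟨(ofCovers h).1.S1_gammaAt_gammaAt, (ofCovers h).2⟩
  tfae_have 3 → 5 := fun h => ⟨fun f =>
    have ⟨_, hgf, hg⟩ := SelCp.exists_tendsto_Cp_ne f
    (ofCovers h).1.S1_seqDenseSets_gammaAt hgf hg, (ofCovers h).2⟩
  tfae_finish
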